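/- Let $F$ be a field of characteristic not two and let $A$ be a commutative (not necessarily associative or unital) $F$-algebra. For $a\in A$, $\lambda\in F$ put $A_\lambda(a)=\{x\in A\mid ax=\lambda x\}$ and $\mathrm{ad}_a(x)=ax$. A \emph{primitive semisimple idempotent with eigenvalues in $\{0,1/2,1\}$} is an element $e\neq0$ with $e^2=e$ such that $\mathrm{ad}_e$ is diagonalizable, all its eigenvalues lie in $\{0,1/2,1\}$, and $A_1(e)=Fe$. Such an $e$ is an \emph{axis} of $A$ if moreover the fusion rules $$A_0(e)^2\subseteq A_0(e),\quad A_{1/2}(e)^2\subseteq A_0(e)+A_1(e),\quad (A_0(e)+A_1(e))A_{1/2}(e)\subseteq A_{1/2}(e),\quad A_0(e)A_1(e)=0$$ hold (axes are thus always primitive). $A$ is an \emph{axial algebra of Jordan type $1/2$} if it is generated as an algebra by its axes. A \emph{Frobenius form} on $A$ is a symmetric bilinear form $(\cdot,\cdot)$ with $(xy,z)=(x,yz)$ for all $x,y,z\in A$ and $(a,a)=1$ for every axis $a$; an axial algebra of Jordan type $1/2$ has exactly one, and $(\cdot,\cdot)$ denotes it. Such an algebra $A$ is \emph{quasi-definite}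 if $(a,b)\ne1$ for all distinct axes $a,b$, and \emph{strongly axial} if every primitive semisimple idempotent with eigenvalues in $\{0,1/2,1\}$ is an axis. A \emph{quasi-definite basis} is a linear basis consisting of axes such that $(x,y)\neq1$ for all distinct basis elements $x,y$. For distinct axes $a,b$ with $(a,b)\neq1$ put $$x_a(b)=\frac{2ab-(a,b)a-b}{(a,b)-1}.$$ Let $A$ be a quasi-definite strongly axial algebra of Jordan type $1/2$ over $F$. Then $A$ has exactly one Frobenius form, and the following hold. (i) For all distinct axes $a,b$ of $A$, the element $x_a(b)$ is an axis of $A$ and an axis of the subalgebra $A_0(a)$; and for every subalgebra $B$ of $A$ containing $a$ and $b$, it is an axis of $B$ and of $A_0(a)\cap B$. (ii) Suppose $\dim A>1$. Then $A$ has a linear basis consisting of axes, and for every axis $a$ of $A$ the subalgebra $A_0(a)$ is an axial algebra of Jordan type $1/2$, it has exactly one Frobenius form, and for every linear basis $X$ of $A$ consisting of axes the set $\{x_a(x)\mid x\in X,\ x\neq a\}$ contains a quasi-definite basis of $A_0(a)$. -/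

import Mathlib

/-!
Commutative, not necessarily associative or unital, algebras `A` over a field `F`
(`[NonUnitalNonAssocCommRing A] [Module F A] [IsScalarTower F A A] [SMulCommClass F A A]`).
-/

namespace JordanAxial

section
variable (F : Type*) {A : Type*} [Field F] [NonUnitalNonAssocCommRing A] [Module F A]
  [IsScalarTower F A A] [SMulCommClass F A A]

/-- The subspace `A_t(a) = {x | a * x = t • x}`: the eigenspace of the operator
`ad_a : x ↦ a * x` for the scalar `t`. -/
def eig (a : A) (t : F) : Submodule F A :=
  Module.End.eigenspace (LinearMap.mulLeft F a) t

theorem mem_eig {a x : A} {t : F} : x ∈ eig F a t ↔ a * x = t • x := by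
  simp [eig]

/-- `e` is a nonzero idempotent, which is semisimple (`ad_e` is diagonalizable), primitive
(`A_1(e)` is spanned by `e`), and all eigenvalues of `ad_e` lie in `{0, 1/2, 1}`. -/
structure IsPrimitiveSemisimpleIdempotent (e : A) : Prop where
  ne_zero : e ≠ 0
  idem : e * e = e
  diagonalizable : ⨆ t : F, eig F e t = ⊤
  spectrum : ∀ t : F, eig F e t ≠ ⊥ → t = 0 ∨ t = 1 / 2 ∨ t = 1
  primitive : eig F e 1 = Submodule.span F {e}

/-- The fusion rules of Jordan type `1/2` for `e`. -/
structure FusionRules (e : A) : Prop where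
  zero_zero : ∀ x ∈ eig F e 0, ∀ y ∈ eig F e 0, x * y ∈ eig F e 0
  half_half : ∀ x ∈ eig F e (1 / 2), ∀ y ∈ eig F e (1 / 2), x * y ∈ eig F e 0 ⊔ eig F e 1
  even_half : ∀ x ∈ eig F e 0 ⊔ eig F e 1, ∀ y ∈ eig F e (1 / 2), x * y ∈ eig F e (1 / 2)
  zero_one : ∀ x ∈ eig F e 0, ∀ y ∈ eig F e 1, x * y = 0

/-- A (primitive) axis of Jordan type `1/2`. -/
structure IsAxis (a : A) : Prop extends IsPrimitiveSemisimpleIdempotent F a, FusionRules F a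

variable {F} in
/-- The subalgebra `A_0(a)`, for an axis `a`. -/
def zeroSubalgebra {a : A} (ha : IsAxis F a) : NonUnitalSubalgebra F A :=
  { eig F a 0 with mul_mem' := fun {x y} hx hy => ha.zero_zero x hx y hy }

variable {F} in
theorem mem_zeroSubalgebra {a : A} (ha : IsAxis F a) {x : A} :
    x ∈ zeroSubalgebra ha ↔ a * x = 0 := by
  change x ∈ eig F a 0 ↔ _
  rw [mem_eig, zero_smul]

/-- The element `x` of `A` belongs to the subalgebra `B` and is an axis of the algebra `B`. -/
def IsAxisOf (B : NonUnitalSubalgebra F A) (x : A) : Prop :=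
  ∃ h : x ∈ B, IsAxis F (⟨x, h⟩ : B)

/-- A Frobenius form: a symmetric invariant bilinear form with `(a, a) = 1` for every axis `a`
(so it is nonzero as soon as there is an axis). -/
structure IsFrobeniusForm (Q : LinearMap.BilinForm F A) : Prop where
  symm : ∀ x y, Q x y = Q y x
  invariant : ∀ x y z, Q (x * y) z = Q x (y * z)
  normalized : ∀ a, IsAxis F a → Q a a = 1

variable (A)

/-- An axial algebra of Jordan type `1/2` (primitive, as always): a commutative algebra
generated by axes. -/
def IsAxialAlgebra : Prop :=
  NonUnitalAlgebra.adjoin F {a : A | IsAxis F a} = ⊤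

open Classical in
/-- The Frobenius form of `A` (an axial algebra of Jordan type `1/2` has exactly one;
the value `0` is taken only if there is none). -/
noncomputable def frobeniusForm : LinearMap.BilinForm F A :=
  if h : ∃ Q : LinearMap.BilinForm F A, IsFrobeniusForm F Q then h.choose else 0

/-- `(a, b) ≠ 1` for all distinct axes `a`, `b`. -/
def IsQuasiDefinite : Prop :=
  ∀ a b : A, IsAxis F a → IsAxis F b → a ≠ b → frobeniusForm F A a b ≠ 1

/-- Every primitive semisimple idempotent with eigenvalues in `{0, 1/2, 1}` is an axis. -/
def IsStronglyAxial : Prop :=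
  ∀ e : A, IsPrimitiveSemisimpleIdempotent F e → IsAxis F e

variable {A}

/-- `X` is a linear basis of `A` consisting of axes of `A`. -/
structure IsAxisBasis (X : Set A) : Prop where
  axis : ∀ x ∈ X, IsAxis F x
  linearIndepOn : LinearIndepOn F id X
  span_eq_top : Submodule.span F X = ⊤

/-- `X` is a linear basis of `A` consisting of axes of `A`, with `(x, y) ≠ 1` for distinct
`x, y ∈ X`. -/
structure IsQuasiDefiniteBasis (X : Set A) : Prop extends IsAxisBasis F X where
  form_ne_one : ∀ x ∈ X, ∀ y ∈ X, x ≠ y → frobeniusForm F A x y ≠ 1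

/-- `x_a(b) = (2ab - (a,b)a - b) / ((a,b) - 1)`. -/
noncomputable def xIdem (a b : A) : A :=
  (frobeniusForm F A a b - 1)⁻¹ •
    ((2 : F) • (a * b) - frobeniusForm F A a b • a - b)

end

end JordanAxial

/-! A primitive idempotent `e` with eigenvalues in {0, 1/2, 1} is governed by one identity: 2 ad_e²
− ad_e is the projection onto `F e`, that is, 2e(ex) = ex + f(x)e for a functional f with f(e) = 1
(`IsCoeff`). For axes this coefficient is symmetric (`IsAxis.coeff_comm`) and invariant under
Miyamoto involutions. As axes span, the coefficients assemble into the unique Frobenius form.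

Let φ = (a,b) ≠ 1. Then x_a(b) is the component v of b in A_0(a), divided by 1 − φ. If φ = 0, the
form is 1 on b and its image under the involution of a; quasi-definiteness makes b fixed, so ab = 0
and x_a(b) = b. If φ ≠ 0, `two_smul_mul_mul_zero_component` gives the rescaled identity for v: its
failure on each eigenspace of a is a vector in A_{1/2}(a) ∩ A_0(b) or A_0(a) ∩ A_{1/2}(b), and both
vanish. So x_a(b) is a primitive semisimple idempotent, hence an axis by strong axiality.

Projecting a basis of axes to A_0(a) yields multiples of the x_a(x), which therefore span. They are
axes of A, and the forms of A and A_0(a) agree on them, so quasi-definiteness of A passes to the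
extracted basis. -/

set_option linter.unusedSectionVars false

/-! ### Coefficient functionals of idempotents and axes -/

namespace JordanAxial

section
variable {F A : Type*} [Field F] [NonUnitalNonAssocCommRing A] [Module F A]
  [IsScalarTower F A A] [SMulCommClass F A A]

/-- The functional `f` is the coefficient of the projection onto `F e` along the other
eigenspaces of `ad_e`. -/
structure IsCoeff (e : A) (f : A →ₗ[F] F) : Prop where
  apply_self : f e = 1
  two_smul_mul_mul : ∀ x, (2 : F) • (e * (e * x)) = e * x + f x • e

theorem IsCoeff.unique {e : A} {f g : A →ₗ[F] F} (hf : IsCoeff e f) (hg : IsCoeff e g) :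
    f = g := by
  have he : e ≠ 0 := by
    rintro rfl
    have := hf.apply_self
    simp at this
  ext x
  have h : f x • e = g x • e := by
    have h1 := hf.two_smul_mul_mul x
    rw [hg.two_smul_mul_mul x] at h1
    exact (add_left_cancel h1).symm
  exact smul_left_injective F he h

open Classical in
/-- The coefficient functional of a primitive semisimple idempotent. -/
noncomputable def coeff (e : A) : A →ₗ[F] F :=
  if h : ∃ f : A →ₗ[F] F, IsCoeff e f then h.choose else 0

theorem IsCoeff.coeff_eq {e : A} {f : A →ₗ[F] F} (hf : IsCoeff e f) : coeff e = f := by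
  have h : ∃ f : A →ₗ[F] F, IsCoeff e f := ⟨f, hf⟩
  rw [coeff, dif_pos h]
  exact h.choose_spec.unique hf

variable [NeZero (2 : F)]

theorem mem_eig_half {e x : A} : x ∈ eig F e (1 / 2) ↔ (2 : F) • (e * x) = x := by
  rw [mem_eig, one_div, eq_inv_smul_iff₀ two_ne_zero]

/-- On A_0, A_{1/2} and A_1 = `F e` the operator 2 ad_e² − ad_e acts as 0, 0 and 1, so its image
lies in `F e` and the functional is read off there. -/
theorem IsPrimitiveSemisimpleIdempotent.isCoeff {e : A}
    (h : IsPrimitiveSemisimpleIdempotent F e) : IsCoeff e (coeff (F := F) e) := by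
  let L := LinearMap.mulLeft F e
  let g : A →ₗ[F] A := (2 : F) • (L ∘ₗ L) - L
  have hg : ∀ x, g x = (2 : F) • (e * (e * x)) - e * x := fun x => rfl
  have hmem : ∀ x, g x ∈ Submodule.span F {e} := by
    have htop : (⊤ : Submodule F A) ≤ (Submodule.span F {e}).comap g := by
      rw [← h.diagonalizable, iSup_le_iff]
      intro t x hx
      rw [Submodule.mem_comap, hg]
      by_cases ht : eig F e t = ⊥
      · rw [ht, Submodule.mem_bot] at hx
        simp [hx]
      · rcases h.spectrum t ht with rfl | rfl | rfl
        · rw [mem_eig, zero_smul] at hx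
          simp [hx]
        · rw [mem_eig_half] at hx
          rw [← mul_smul_comm, hx, sub_self]
          exact zero_mem _
        · rw [h.primitive] at hx
          obtain ⟨r, rfl⟩ := Submodule.mem_span_singleton.1 hx
          simp only [mul_smul_comm, h.idem]
          exact sub_mem (Submodule.smul_mem _ _ hx) hx
    exact fun x => htop trivial
  let f : A →ₗ[F] F :=
    (LinearEquiv.toSpanNonzeroSingleton F A e h.ne_zero).symm.toLinearMap ∘ₗ g.codRestrict _ hmem
  have hf : ∀ x, f x • e = g x := fun x => by
    have := LinearEquiv.apply_symm_apply (LinearEquiv.toSpanNonzeroSingleton F A e h.ne_zero)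
      (g.codRestrict _ hmem x)
    exact congrArg Subtype.val this
  have hc : IsCoeff e f := by
    refine ⟨smul_left_injective F h.ne_zero ?_, fun x => ?_⟩
    · change f e • e = (1 : F) • e
      rw [hf, hg, h.idem, h.idem]
      module
    · rw [hf, hg]
      abel
  rw [hc.coeff_eq]
  exact hc

namespace IsCoeff
variable {e : A} {f : A →ₗ[F] F}

theorem ne_zero (h : IsCoeff e f) : e ≠ 0 := by
  rintro rfl
  have := h.apply_self
  simp at this

theorem apply_of_half (h : IsCoeff e f) {x : A} (hx : (2 : F) • (e * x) = x) : f x = 0 := by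
  have h1 := h.two_smul_mul_mul x
  rw [← mul_smul_comm, hx] at h1
  have h2 : f x • e = 0 := by simpa using h1.symm
  exact (smul_eq_zero.1 h2).resolve_right h.ne_zero

theorem apply_of_zero (h : IsCoeff e f) {x : A} (hx : e * x = 0) : f x = 0 := by
  have h1 := h.two_smul_mul_mul x
  rw [hx, mul_zero, smul_zero, zero_add] at h1
  exact (smul_eq_zero.1 h1.symm).resolve_right h.ne_zero

/-- The component of an element in `A_{1/2}(e)`. -/
theorem two_smul_mul_half (h : IsCoeff e f) (hi : e * e = e) (x : A) :
    (2 : F) • (e * ((2 : F) • (e * x) - (2 : F) • f x • e)) =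
      (2 : F) • (e * x) - (2 : F) • f x • e := by
  simp only [mul_sub, mul_smul_comm, hi]
  linear_combination (norm := module) (2 : F) • h.two_smul_mul_mul x

/-- The component of an element in `A_0(e)`. -/
theorem mul_zero_component (h : IsCoeff e f) (hi : e * e = e) (x : A) :
    e * (x - (2 : F) • (e * x) + f x • e) = 0 := by
  simp only [mul_sub, mul_add, mul_smul_comm, hi]
  linear_combination (norm := module) - h.two_smul_mul_mul x

theorem apply_mul (h : IsCoeff e f) (hi : e * e = e) (x : A) : f (e * x) = f x := by
  have h1 := h.apply_of_half (h.two_smul_mul_half hi x)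
  simp only [map_sub, map_smul, h.apply_self, smul_eq_mul, mul_one] at h1
  exact mul_left_cancel₀ two_ne_zero (sub_eq_zero.1 h1)

theorem mem_even_iff (h : IsCoeff e f) (hi : e * e = e) {x : A} :
    x ∈ eig F e 0 ⊔ eig F e 1 ↔ e * x = f x • e := by
  constructor
  · intro hx
    obtain ⟨y, hy, z, hz, rfl⟩ := Submodule.mem_sup.1 hx
    rw [mem_eig, zero_smul] at hy
    rw [mem_eig, one_smul] at hz
    have h1 := h.two_smul_mul_mul z
    rw [hz, hz] at h1
    rw [mul_add, hy, hz, zero_add, map_add, h.apply_of_zero hy, zero_add]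
    linear_combination (norm := module) h1
  · intro hx
    refine Submodule.mem_sup.2 ⟨x - f x • e, ?_, f x • e, ?_, by abel⟩
    · rw [mem_eig, mul_sub, mul_smul_comm, hi, hx, sub_self, zero_smul]
    · rw [mem_eig, mul_smul_comm, hi, one_smul]

/-- The quadratic identity makes the three explicit components of x eigenvectors, and they sum to x.
An eigenvector with f(x) ≠ 0 has eigenvalue 1; otherwise t(2t − 1) = 0. -/
theorem isPrimitiveSemisimpleIdempotent (h : IsCoeff e f) (hi : e * e = e) :
    IsPrimitiveSemisimpleIdempotent F e where
  ne_zero := h.ne_zero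
  idem := hi
  diagonalizable := by
    rw [eq_top_iff]
    intro x _
    have h1 : f x • e ∈ ⨆ t : F, eig F e t := by
      refine Submodule.mem_iSup_of_mem 1 ?_
      rw [mem_eig, mul_smul_comm, hi, one_smul]
    have h2 := Submodule.mem_iSup_of_mem (p := eig F e) (1 / 2)
      (mem_eig_half.2 (h.two_smul_mul_half hi x))
    have h3 : x - (2 : F) • (e * x) + f x • e ∈ ⨆ t : F, eig F e t := by
      refine Submodule.mem_iSup_of_mem 0 ?_
      rw [mem_eig, zero_smul, h.mul_zero_component hi]
    convert add_mem (add_mem h1 h2) h3 using 1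
    module
  spectrum := by
    intro t ht
    obtain ⟨x, hx, hx0⟩ := Submodule.exists_mem_ne_zero_of_ne_bot ht
    rw [mem_eig] at hx
    have h1 := h.apply_mul hi x
    rw [hx, map_smul, smul_eq_mul] at h1
    by_cases hf : f x = 0
    · have h2 := h.two_smul_mul_mul x
      rw [hf, hx, mul_smul_comm, hx] at h2
      have h3 : (t * (2 * t - 1)) • x = 0 := by linear_combination (norm := module) h2
      rcases mul_eq_zero.1 ((smul_eq_zero.1 h3).resolve_right hx0) with h4 | h4
      · exact Or.inl h4
      · refine Or.inr (Or.inl ?_)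
        rw [eq_div_iff two_ne_zero]
        linear_combination h4
    · exact Or.inr (Or.inr (mul_right_cancel₀ hf (h1.trans (one_mul _).symm)))
  primitive := by
    ext x
    rw [mem_eig, one_smul, Submodule.mem_span_singleton]
    constructor
    · intro hx
      refine ⟨f x, ?_⟩
      have h1 := h.two_smul_mul_mul x
      rw [hx, hx] at h1
      linear_combination (norm := module) -h1
    · rintro ⟨r, rfl⟩
      rw [mul_smul_comm, hi]

/-- Since A_1(e) = `F e`, the fusion rules involving A_1 on the left or right are automatic; only
these three need checking. -/
theorem isAxis (h : IsCoeff e f) (hi : e * e = e)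
    (h00 : ∀ x y, e * x = 0 → e * y = 0 → e * (x * y) = 0)
    (hhh : ∀ x y, (2 : F) • (e * x) = x → (2 : F) • (e * y) = y → e * (x * y) = f (x * y) • e)
    (h0h : ∀ x y, e * x = 0 → (2 : F) • (e * y) = y → (2 : F) • (e * (x * y)) = x * y) :
    IsAxis F e where
  toIsPrimitiveSemisimpleIdempotent := h.isPrimitiveSemisimpleIdempotent hi
  zero_zero x hx y hy := by
    rw [mem_eig, zero_smul] at *
    exact h00 x y hx hy
  half_half x hx y hy := by
    rw [h.mem_even_iff hi]
    exact hhh x y (mem_eig_half.1 hx) (mem_eig_half.1 hy)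
  even_half x hx y hy := by
    obtain ⟨z, hz, z', hz', rfl⟩ := Submodule.mem_sup.1 hx
    rw [mem_eig, zero_smul] at hz
    rw [(h.isPrimitiveSemisimpleIdempotent hi).primitive] at hz'
    obtain ⟨r, rfl⟩ := Submodule.mem_span_singleton.1 hz'
    rw [mem_eig_half] at *
    rw [add_mul, mul_add, smul_add, h0h z y hz hy, smul_mul_assoc, mul_smul_comm, smul_comm,
      ← mul_smul_comm (2 : F), hy]
  zero_one x hx y hy := by
    rw [mem_eig, zero_smul] at hx
    rw [(h.isPrimitiveSemisimpleIdempotent hi).primitive] at hy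
    obtain ⟨r, rfl⟩ := Submodule.mem_span_singleton.1 hy
    rw [mul_smul_comm, mul_comm, hx, smul_zero]

end IsCoeff

namespace IsAxis
variable {a : A}

theorem isCoeff (ha : IsAxis F a) : IsCoeff a (coeff (F := F) a) :=
  ha.toIsPrimitiveSemisimpleIdempotent.isCoeff

theorem mul_mul_of_zero_zero (ha : IsAxis F a) {x y : A} (hx : a * x = 0) (hy : a * y = 0) :
    a * (x * y) = 0 := by
  have := ha.zero_zero x (by rw [mem_eig, hx, zero_smul]) y (by rw [mem_eig, hy, zero_smul])
  rwa [mem_eig, zero_smul] at this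

theorem mul_mul_of_half_half (ha : IsAxis F a) {x y : A} (hx : (2 : F) • (a * x) = x)
    (hy : (2 : F) • (a * y) = y) : a * (x * y) = coeff (F := F) a (x * y) • a :=
  (ha.isCoeff.mem_even_iff ha.idem).1
    (ha.half_half x (mem_eig_half.2 hx) y (mem_eig_half.2 hy))

theorem two_smul_mul_mul_of_zero_half (ha : IsAxis F a) {x y : A} (hx : a * x = 0)
    (hy : (2 : F) • (a * y) = y) : (2 : F) • (a * (x * y)) = x * y := by
  refine mem_eig_half.1 (ha.even_half x (Submodule.mem_sup_left ?_) y (mem_eig_half.2 hy))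
  rw [mem_eig, hx, zero_smul]

/-- Every element is the sum of its components in the eigenspaces of an axis. -/
theorem exists_components (ha : IsAxis F a) (x : A) :
    ∃ y z : A, (2 : F) • (a * y) = y ∧ a * z = 0 ∧ x = coeff (F := F) a x • a + y + z :=
  ⟨_, _, ha.isCoeff.two_smul_mul_half ha.idem x, ha.isCoeff.mul_zero_component ha.idem x, by
    module⟩

/-- By fusion, A_0(a)·A lies in A_0(a) + A_{1/2}(a), where the coefficient vanishes. -/
theorem coeff_mul_of_zero (ha : IsAxis F a) {x : A} (hx : a * x = 0) (y : A) :
    coeff (F := F) a (x * y) = 0 := by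
  obtain ⟨u, v, hu, hv, hy⟩ := ha.exists_components (F := F) y
  rw [hy, mul_add, mul_add, mul_smul_comm, mul_comm x a, hx, smul_zero, zero_add, map_add,
    ha.isCoeff.apply_of_half (ha.two_smul_mul_mul_of_zero_half hx hu),
    ha.isCoeff.apply_of_zero (ha.mul_mul_of_zero_zero hx hv), add_zero]

/-- `ad_a` commutes with `ad_x` for `x` in `A_0(a)`. -/
theorem mul_mul_comm_of_zero (ha : IsAxis F a) {x : A} (hx : a * x = 0) (y : A) :
    a * (x * y) = x * (a * y) := by
  obtain ⟨u, v, hu, hv, hy⟩ := ha.exists_components (F := F) y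
  have h1 : a * (x * u) = x * (a * u) := by
    refine smul_right_injective A (two_ne_zero (α := F)) ?_
    change (2 : F) • (a * (x * u)) = (2 : F) • (x * (a * u))
    rw [ha.two_smul_mul_mul_of_zero_half hx hu, ← mul_smul_comm, hu]
  rw [hy]
  simp only [mul_add, mul_smul_comm, ha.idem, mul_comm x a, hx, hv, h1, mul_zero, smul_zero,
    ha.mul_mul_of_zero_zero hx hv]

/-- The coefficient of one axis at another one is symmetric. -/
theorem coeff_comm {b : A} (ha : IsAxis F a) (hb : IsAxis F b) :
    coeff (F := F) a b = coeff (F := F) b a := by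
  -- Multiply the A_0(a)-component of b by b and take the a-coefficient, which is zero. Adding the
  -- relation with a and b exchanged gives a vanishing square.
  have key : ∀ {a b : A}, IsAxis F a → IsAxis F b →
      coeff (F := F) a b * (coeff (F := F) a b - coeff (F := F) b a) = 0 := by
    intro a b ha hb
    have h0 := ha.coeff_mul_of_zero (ha.isCoeff.mul_zero_component (F := F) ha.idem b) b
    have h1 := hb.isCoeff.two_smul_mul_mul (F := F) a
    have h2 : (b - (2 : F) • (a * b) + coeff (F := F) a b • a) * b =
        b - (a * b + coeff (F := F) b a • b) + coeff (F := F) a b • (a * b) := by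
      rw [add_mul, sub_mul, smul_mul_assoc, smul_mul_assoc, hb.idem, mul_comm (a * b) b,
        mul_comm a b, h1]
    rw [h2] at h0
    simp only [map_add, map_sub, map_smul, smul_eq_mul, ha.isCoeff.apply_mul ha.idem] at h0
    linear_combination h0
  have h := key ha hb
  have h' := key hb ha
  have : (coeff (F := F) a b - coeff (F := F) b a) ^ 2 = 0 := by linear_combination h + h'
  exact sub_eq_zero.1 (pow_eq_zero_iff two_ne_zero |>.1 this)

end IsAxis
end
end JordanAxial

/-! ### Miyamoto involutions -/

namespace JordanAxial

section
variable {F A : Type*} [Field F] [NonUnitalNonAssocCommRing A] [Module F A]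
  [IsScalarTower F A A] [SMulCommClass F A A]

/-- Coefficient functionals are transported by involutive automorphisms. -/
theorem IsCoeff.map {e : A} {f : A →ₗ[F] F} (h : IsCoeff e f) {g : A →ₗ[F] A}
    (hg : ∀ x y, g (x * y) = g x * g y) (hgg : ∀ x, g (g x) = x) :
    IsCoeff (g e) (f ∘ₗ g) where
  apply_self := by
    rw [LinearMap.comp_apply, hgg, h.apply_self]
  two_smul_mul_mul x := by
    have h1 := congrArg g (h.two_smul_mul_mul (g x))
    simpa only [map_smul, map_add, hg, hgg, LinearMap.comp_apply] using h1

variable [NeZero (2 : F)]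

namespace IsAxis
variable {a : A}

theorem map (ha : IsAxis F a) {g : A →ₗ[F] A}
    (hg : ∀ x y, g (x * y) = g x * g y) (hgg : ∀ x, g (g x) = x) : IsAxis F (g a) := by
  have hz : ∀ x, g a * x = 0 → a * g x = 0 := fun x hx => by
    rw [← hgg a, ← hg, hx, map_zero]
  have hh : ∀ x, (2 : F) • (g a * x) = x → (2 : F) • (a * g x) = g x := fun x hx => by
    conv_rhs => rw [← hx]
    rw [map_smul, hg, hgg]
  refine (ha.isCoeff (F := F).map hg hgg).isAxis (by rw [← hg, ha.idem]) ?_ ?_ ?_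
  · intro x y hx hy
    have h1 := congrArg g (ha.mul_mul_of_zero_zero (hz x hx) (hz y hy))
    simpa only [hg, hgg, map_zero] using h1
  · intro x y hx hy
    have h1 := congrArg g (ha.mul_mul_of_half_half (hh x hx) (hh y hy))
    simpa only [hg, hgg, map_smul, LinearMap.comp_apply] using h1
  · intro x y hx hy
    have h1 := congrArg g (ha.two_smul_mul_mul_of_zero_half (hz x hx) (hh y hy))
    simpa only [hg, hgg, map_smul, map_zero] using h1

end IsAxis

/-- The Miyamoto involution of an axis `a`: it negates `A_{1/2}(a)` and fixes
`A_0(a) + A_1(a)`. -/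
noncomputable def miyamoto (a : A) : A →ₗ[F] A :=
  LinearMap.id - (4 : F) • LinearMap.mulLeft F a + (4 : F) • (coeff a).smulRight a

theorem miyamoto_apply (a x : A) :
    miyamoto (F := F) a x = x - (4 : F) • (a * x) + (4 : F) • coeff (F := F) a x • a := rfl

theorem miyamoto_of_even {a x : A} (hx : a * x = coeff (F := F) a x • a) :
    miyamoto (F := F) a x = x := by
  rw [miyamoto_apply, hx]
  module

namespace IsAxis
variable {a : A}

theorem miyamoto_self (ha : IsAxis F a) : miyamoto (F := F) a a = a := by
  rw [miyamoto_apply, ha.idem, ha.isCoeff.apply_self]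
  module

theorem miyamoto_of_zero (ha : IsAxis F a) {x : A} (hx : a * x = 0) :
    miyamoto (F := F) a x = x :=
  miyamoto_of_even (by rw [hx, ha.isCoeff.apply_of_zero hx, zero_smul])

theorem miyamoto_of_half (ha : IsAxis F a) {x : A} (hx : (2 : F) • (a * x) = x) :
    miyamoto (F := F) a x = -x := by
  rw [miyamoto_apply, ha.isCoeff.apply_of_half hx]
  linear_combination (norm := module) (-2 : F) • hx

theorem miyamoto_miyamoto (ha : IsAxis F a) (x : A) :
    miyamoto (F := F) a (miyamoto (F := F) a x) = x := by
  obtain ⟨y, z, hy, hz, hx⟩ := ha.exists_components (F := F) x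
  rw [hx]
  simp only [map_add, map_smul, ha.miyamoto_self, ha.miyamoto_of_half hy, ha.miyamoto_of_zero hz,
    map_neg, neg_neg]

theorem miyamoto_mul (ha : IsAxis F a) (x y : A) :
    miyamoto (F := F) a (x * y) = miyamoto (F := F) a x * miyamoto (F := F) a y := by
  obtain ⟨x₁, x₀, hx₁, hx₀, hx⟩ := ha.exists_components (F := F) x
  obtain ⟨y₁, y₀, hy₁, hy₀, hy⟩ := ha.exists_components (F := F) y
  have hax : miyamoto (F := F) a (a * x₁) = -(a * x₁) :=
    ha.miyamoto_of_half (by rw [← mul_smul_comm, hx₁])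
  have hay : miyamoto (F := F) a (a * y₁) = -(a * y₁) :=
    ha.miyamoto_of_half (by rw [← mul_smul_comm, hy₁])
  have h1 := miyamoto_of_even (ha.mul_mul_of_half_half hx₁ hy₁)
  have h2 := ha.miyamoto_of_half (ha.two_smul_mul_mul_of_zero_half hx₀ hy₁)
  have h3 := ha.miyamoto_of_half (ha.two_smul_mul_mul_of_zero_half hy₀ hx₁)
  have h4 := ha.miyamoto_of_zero (ha.mul_mul_of_zero_zero hx₀ hy₀)
  rw [mul_comm y₀] at h3
  rw [hx, hy]
  simp only [mul_add, add_mul, smul_mul_assoc, mul_smul_comm, map_add, map_smul, ha.idem, hax, hay,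
    h1, h2, h3, h4, mul_comm x₁ a, mul_comm x₀ a, hx₀, hy₀, map_zero, smul_zero,
    ha.miyamoto_self, ha.miyamoto_of_half hx₁, ha.miyamoto_of_half hy₁, ha.miyamoto_of_zero hx₀,
    ha.miyamoto_of_zero hy₀, neg_mul, mul_neg]
  module

theorem miyamoto {b : A} (ha : IsAxis F a) (hb : IsAxis F b) :
    IsAxis F (miyamoto (F := F) a b) :=
  hb.map ha.miyamoto_mul ha.miyamoto_miyamoto

theorem coeff_miyamoto {b : A} (ha : IsAxis F a) (hb : IsAxis F b) (x : A) :
    coeff (F := F) (JordanAxial.miyamoto (F := F) a b) (JordanAxial.miyamoto (F := F) a x) =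
      coeff (F := F) b x := by
  rw [(hb.isCoeff.map ha.miyamoto_mul ha.miyamoto_miyamoto).coeff_eq, LinearMap.comp_apply,
    ha.miyamoto_miyamoto]

end IsAxis

/-! ### Spanning by axes and the Frobenius form -/

/-- An axial algebra of Jordan type `1/2` is spanned by its axes. -/
theorem IsAxialAlgebra.span_eq_top (hA : IsAxialAlgebra F A) :
    Submodule.span F {a : A | IsAxis F a} = ⊤ := by
  have hmul : ∀ x ∈ Submodule.span F {a : A | IsAxis F a},
      ∀ y ∈ Submodule.span F {a : A | IsAxis F a},
      x * y ∈ Submodule.span F {a : A | IsAxis F a} := by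
    intro x hx y hy
    induction hx, hy using Submodule.span_induction₂ with
    | mem_mem a b ha hb =>
      -- Solving the formula for the Miyamoto involution for ab writes the product of two axes as a
      -- combination of axes.
      have h : a * b = (4 : F)⁻¹ • (b - miyamoto (F := F) a b) + coeff (F := F) a b • a := by
        have h4 : (4 : F) ≠ 0 := by
          rw [show (4 : F) = 2 * 2 by norm_num]
          exact mul_ne_zero two_ne_zero two_ne_zero
        rw [miyamoto_apply, show b - (b - (4 : F) • (a * b) + (4 : F) • coeff (F := F) a b • a) =
          (4 : F) • (a * b - coeff (F := F) a b • a) by module, inv_smul_smul₀ h4]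
        abel
      rw [h]
      exact add_mem (Submodule.smul_mem _ _ (sub_mem (Submodule.subset_span hb)
        (Submodule.subset_span (IsAxis.miyamoto ha hb))))
        (Submodule.smul_mem _ _ (Submodule.subset_span ha))
    | zero_left y hy => simp
    | zero_right x hx => simp
    | add_left x y z _ _ _ h1 h2 => rw [add_mul]; exact add_mem h1 h2
    | add_right x y z _ _ _ h1 h2 => rw [mul_add]; exact add_mem h1 h2
    | smul_left r x y _ _ h => rw [smul_mul_assoc]; exact Submodule.smul_mem _ _ h
    | smul_right r x y _ _ h => rw [mul_smul_comm]; exact Submodule.smul_mem _ _ h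
  rw [eq_top_iff]
  intro x _
  have hx : x ∈ NonUnitalAlgebra.adjoin F {a : A | IsAxis F a} := by
    rw [show NonUnitalAlgebra.adjoin F {a : A | IsAxis F a} = ⊤ from hA]
    trivial
  induction hx using NonUnitalAlgebra.adjoin_induction with
  | mem x hx => exact Submodule.subset_span hx
  | add x y _ _ h1 h2 => exact add_mem (h1 trivial) (h2 trivial)
  | zero => exact zero_mem _
  | mul x y _ _ h1 h2 => exact hmul x (h1 trivial) y (h2 trivial)
  | smul r x _ h => exact Submodule.smul_mem _ _ (h trivial)

theorem IsAxialAlgebra.of_span_eq_top {X : Set A} (hX : ∀ x ∈ X, IsAxis F x)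
    (h : Submodule.span F X = ⊤) : IsAxialAlgebra F A := by
  refine eq_top_iff.2 fun x _ => ?_
  have hx : x ∈ Submodule.span F X := h ▸ Submodule.mem_top
  exact Submodule.span_le (p := (NonUnitalAlgebra.adjoin F {a : A | IsAxis F a}).toSubmodule).2
    (fun y hy => NonUnitalAlgebra.subset_adjoin F (hX y hy)) hx

/-- A spanning set of axes contains a basis of axes. -/
theorem exists_isAxisBasis_subset {X : Set A} (hX : ∀ x ∈ X, IsAxis F x)
    (h : Submodule.span F X = ⊤) : ∃ Y ⊆ X, IsAxisBasis F Y := by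
  obtain ⟨Y, hYX, hspan, hli⟩ := exists_linearIndependent F X
  exact ⟨Y, hYX, fun y hy => hX y (hYX hy), hli, hspan.trans h⟩

/-- Invariance gives Q(a, ay) = Q(a, y), so applying Q(a, ·) to the quadratic identity isolates the
coefficient. Uniqueness of the form follows. -/
theorem IsFrobeniusForm.apply_axis {Q : LinearMap.BilinForm F A} (hQ : IsFrobeniusForm F Q)
    {a : A} (ha : IsAxis F a) (x : A) : Q a x = coeff (F := F) a x := by
  have h1 : ∀ y, Q a (a * y) = Q a y := fun y => by rw [← hQ.invariant, ha.idem]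
  have h2 := congrArg (Q a) (ha.isCoeff.two_smul_mul_mul (F := F) x)
  simp only [map_smul, map_add, h1, hQ.normalized a ha, smul_eq_mul, mul_one] at h2
  linear_combination h2

/-- An axial algebra of Jordan type `1/2` has exactly one Frobenius form. -/
theorem IsAxialAlgebra.existsUnique_isFrobeniusForm (hA : IsAxialAlgebra F A) :
    ∃! Q : LinearMap.BilinForm F A, IsFrobeniusForm F Q := by
  have hspan := hA.span_eq_top
  obtain ⟨X, -, hX⟩ := exists_isAxisBasis_subset (fun x hx => hx) hspan
  let B : Module.Basis X F A := Module.Basis.mk hX.linearIndepOn (by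
    rw [← hX.span_eq_top]; simp)
  have hB : ∀ i, B i = (i : A) := fun i => by simp [B]
  let Q : LinearMap.BilinForm F A := B.constr F (fun i => coeff (F := F) (i : A))
  have hQX : ∀ i : X, Q i = coeff (F := F) (i : A) := fun i => by
    conv_lhs => rw [← hB i]
    exact B.constr_basis F _ i
  have hQ : ∀ a, IsAxis F a → Q a = coeff (F := F) a := by
    intro a ha
    refine LinearMap.ext_on hspan fun y hy => ?_
    have h : LinearMap.flip Q y = coeff (F := F) y := by
      refine B.ext fun i => ?_
      rw [LinearMap.flip_apply, hB, hQX, IsAxis.coeff_comm (hX.axis i i.2) hy]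
    rw [← LinearMap.flip_apply, h, IsAxis.coeff_comm hy ha]
  have hsymm : ∀ x y, Q x y = Q y x := by
    have h : Q = LinearMap.flip Q := by
      refine LinearMap.ext_on hspan fun x hx => LinearMap.ext_on hspan fun y hy => ?_
      rw [LinearMap.flip_apply, hQ x hx, hQ y hy, IsAxis.coeff_comm hx hy]
    intro x y
    conv_lhs => rw [h]
    rfl
  have hinv : ∀ a x y, IsAxis F a → Q (x * a) y = Q x (a * y) := by
    intro a x y ha
    -- The involution τ of a preserves Q, hence is self-adjoint; expanding Q(τx, y) = Q(x, τy)
    -- leaves the invariance relation for a.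
    have h1 : Q.compl₁₂ (miyamoto (F := F) a) (miyamoto (F := F) a) = Q := by
      refine LinearMap.ext_on hspan fun x hx => LinearMap.ext fun y => ?_
      rw [LinearMap.compl₁₂_apply, hQ x hx, hQ _ (IsAxis.miyamoto ha hx), ha.coeff_miyamoto hx]
    have h2 := LinearMap.congr_fun₂ h1 x (miyamoto (F := F) a y)
    rw [LinearMap.compl₁₂_apply, ha.miyamoto_miyamoto, miyamoto_apply, miyamoto_apply] at h2
    simp only [map_add, map_sub, map_smul, LinearMap.add_apply, LinearMap.sub_apply,
      LinearMap.smul_apply, smul_eq_mul] at h2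
    rw [hsymm x a, hQ a ha] at h2
    have h4 : (2 : F) * (2 * (Q (x * a) y - Q x (a * y))) = 0 := by
      rw [mul_comm x a]
      linear_combination -h2
    have h5 := (mul_eq_zero.1 h4).resolve_left two_ne_zero
    exact sub_eq_zero.1 ((mul_eq_zero.1 h5).resolve_left two_ne_zero)
  refine ⟨Q, ⟨hsymm, fun x y z => ?_, fun a ha => ?_⟩, fun Q' hQ' => ?_⟩
  · have hy : y ∈ Submodule.span F {a : A | IsAxis F a} := hspan ▸ Submodule.mem_top
    induction hy using Submodule.span_induction with
    | mem a ha => exact hinv a x z ha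
    | zero => simp
    | add y y' _ _ h h' => simp only [mul_add, add_mul, map_add, LinearMap.add_apply, h, h']
    | smul r y _ h =>
      simp only [mul_smul_comm, smul_mul_assoc, map_smul, LinearMap.smul_apply, h]
  · rw [hQ a ha, ha.isCoeff.apply_self]
  · refine LinearMap.ext_on hspan fun x hx => LinearMap.ext fun y => ?_
    rw [hQ'.apply_axis hx, hQ x hx]

theorem IsAxialAlgebra.isFrobeniusForm (hA : IsAxialAlgebra F A) :
    IsFrobeniusForm F (frobeniusForm F A) := by
  have h := hA.existsUnique_isFrobeniusForm.exists
  rw [frobeniusForm, dif_pos h]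
  exact h.choose_spec

end
end JordanAxial

/-! ### The quadratic identity for the A_0(a)-component of b -/

namespace JordanAxial

section
variable {F A : Type*} [Field F] [NonUnitalNonAssocCommRing A] [Module F A]
  [IsScalarTower F A A] [SMulCommClass F A A] [NeZero (2 : F)]

theorem two_smul_cancel {M : Type*} [AddCommGroup M] [Module F M] {x y : M}
    (h : (2 : F) • x = (2 : F) • y) : x = y :=
  smul_right_injective M (two_ne_zero (α := F)) h

namespace IsAxis
variable {a b : A}

/-- `A_{1/2}(a) ∩ A_0(b) = 0` unless `(a, b) = 0`. -/
theorem eq_zero_of_half_of_zero (ha : IsAxis F a) (hb : IsAxis F b)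
    (hφ : coeff (F := F) a b ≠ 0) {x : A} (hx : (2 : F) • (a * x) = x) (hbx : b * x = 0) :
    x = 0 := by
  -- Applying the involution of a to bx = 0 gives (ab)x = φ·ax. Also (ab)x = b(ax), because ad_b and
  -- ad_x commute, and b(ax) = 0 because ax = x/2. So φx = 0.
  have h1 := ha.miyamoto_mul (F := F) b x
  rw [hbx, map_zero, ha.miyamoto_of_half hx, miyamoto_apply] at h1
  have h2 : (2 : F) • (a * b * x) = (2 : F) • coeff (F := F) a b • (a * x) := by
    refine two_smul_cancel (F := F) ?_
    simp only [mul_neg, add_mul, sub_mul, smul_mul_assoc, hbx] at h1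
    linear_combination (norm := module) -h1
  have h3 := hb.mul_mul_comm_of_zero hbx a
  rw [mul_comm x a, mul_comm b a, mul_comm x] at h3
  have h4 : (2 : F) • (b * (a * x)) = 0 := by rw [← mul_smul_comm, hx, hbx]
  rw [h3, h2, smul_comm, hx] at h4
  exact (smul_eq_zero.1 h4).resolve_left hφ

/-- The element a + b − 2ab is a multiple of a plus an element of A_0(a). It is symmetric in a and
b, so its multiplication commutes with both ad_a and ad_b. -/
theorem mul_sum_comm (ha : IsAxis F a) (b x : A) :
    a * ((a + b - (2 : F) • (a * b)) * x) = (a + b - (2 : F) • (a * b)) * (a * x) := by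
  have h := ha.mul_mul_comm_of_zero (ha.isCoeff.mul_zero_component (F := F) ha.idem b) x
  have h1 : a + b - (2 : F) • (a * b) =
      (b - (2 : F) • (a * b) + coeff (F := F) a b • a) + (1 - coeff (F := F) a b) • a := by module
  rw [h1, add_mul _ _ x, add_mul _ _ (a * x), mul_add, h, smul_mul_assoc, smul_mul_assoc,
    mul_smul_comm]

end IsAxis

/-- The component of `b` in `A_0(a)` is a multiple of an idempotent whose multiplication operator
satisfies the quadratic equation of a primitive idempotent. -/
theorem IsFrobeniusForm.two_smul_mul_mul_zero_component {Q : LinearMap.BilinForm F A}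
    (hQ : IsFrobeniusForm F Q) {a b v : A} {φ : F} (ha : IsAxis F a) (hb : IsAxis F b)
    (hφ : φ = Q a b) (hφ0 : φ ≠ 0) (hv : v = b - (2 : F) • (a * b) + φ • a) :
    v * v = (1 - φ) • v ∧
      ∀ x, (2 : F) • (v * (v * x)) = (1 - φ) • (v * x) + Q v x • v := by
  have hφ' : φ = coeff (F := F) a b := by rw [hφ, hQ.apply_axis ha]
  have hφ'' : φ = coeff (F := F) b a := by rw [hφ, hQ.symm, hQ.apply_axis hb]
  obtain ⟨w, hw⟩ : ∃ w, w = (2 : F) • (a * b) - (2 : F) • φ • a := ⟨_, rfl⟩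
  obtain ⟨s, hs⟩ : ∃ s, s = a + b - (2 : F) • (a * b) := ⟨_, rfl⟩
  have hav : a * v = 0 := by
    rw [hv, hφ']
    exact ha.isCoeff.mul_zero_component ha.idem b
  have haw : (2 : F) • (a * w) = w := by
    rw [hw, hφ']
    exact ha.isCoeff.two_smul_mul_half ha.idem b
  have hsv : s = (1 - φ) • a + v := by rw [hs, hv]; module
  have hbvw : b = φ • a + v + w := by rw [hw, hv]; module
  have hbs : b = s + (2 * φ - 1) • a + w := by rw [hs, hw]; module
  have has : ∀ x, a * (s * x) = s * (a * x) := fun x => by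
    rw [hs]
    exact ha.mul_sum_comm b x
  have hbs' : ∀ x, b * (s * x) = s * (b * x) := fun x => by
    rw [hs, add_comm a b, mul_comm a b]
    exact hb.mul_sum_comm a x
  have hτa := ha.miyamoto_self (F := F)
  have hτs : miyamoto (F := F) a s = s := by
    rw [hsv, map_add, map_smul, hτa, ha.miyamoto_of_zero hav]
  have hτb : miyamoto (F := F) a b = s + (2 * φ - 1) • a - w := by
    conv_lhs => rw [hbs]
    rw [map_add, map_add, map_smul, hτs, hτa, ha.miyamoto_of_half haw]
    module
  -- The involution of a fixes s and a and negates w; comparing commutation of s with b and with its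
  -- image isolates w.
  have hws : ∀ x, w * (s * x) = s * (w * x) := by
    intro x
    have h1 := congrArg (miyamoto (F := F) a) (hbs' (miyamoto (F := F) a x))
    simp only [ha.miyamoto_mul, ha.miyamoto_miyamoto, hτs, hτb] at h1
    have h2 := hbs' x
    rw [hbs] at h2
    refine two_smul_cancel (F := F) ?_
    simp only [add_mul, sub_mul, mul_add, mul_sub, smul_mul_assoc, mul_smul_comm, has] at h1 h2
    linear_combination (norm := module) h2 - h1
  have hb' := ha.miyamoto hb
  rw [hτb] at hb'
  -- products of `a`, `v`, `w`, `s`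
  have hvv : v * v = (1 - φ) • v := by
    have h1 : v * b = (1 - φ) • (b - a * b) := by
      rw [hv, add_mul, sub_mul, smul_mul_assoc, smul_mul_assoc, hb.idem, mul_comm (a * b) b,
        mul_comm a b, hb.isCoeff.two_smul_mul_mul, ← hφ'']
      module
    -- In vb = vv + vw the summands lie in A_0(a) and A_{1/2}(a), so vv = vb − 2a(vb).
    have h2 := ha.two_smul_mul_mul_of_zero_half hav haw
    have h3 : v * b = v * v + v * w := by
      conv_lhs => rw [hbvw]
      rw [mul_add, mul_add, mul_smul_comm, mul_comm v a, hav, smul_zero, zero_add]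
    have h4 : a * (v * b) = a * (v * w) := by
      rw [h3, mul_add, ha.mul_mul_of_zero_zero hav hav, zero_add]
    have h5 := ha.isCoeff.two_smul_mul_mul (F := F) b
    rw [← hφ'] at h5
    rw [h1, mul_smul_comm, mul_sub] at h4
    rw [h1] at h3
    conv_rhs => rw [hv]
    linear_combination (norm := module) -h3 + h2 + (2 : F) • h4 + (1 - φ) • h5
  -- Even and odd parts of the idempotency of b = φa + v + w, obtained by also using its image φa +
  -- v − w.
  have hbb : (φ • a + v) * (φ • a + v) + w * w = φ • a + v ∧
      (2 : F) • ((φ • a + v) * w) = w := by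
    have h1 := hb.idem
    have h2 := hb'.idem
    rw [hbvw] at h1
    rw [show s + (2 * φ - 1) • a - w = φ • a + v - w by rw [hsv]; module] at h2
    simp only [add_mul, sub_mul, mul_add, mul_sub, smul_mul_assoc, mul_smul_comm, mul_comm w a,
      mul_comm w v, mul_comm v a] at h1 h2 ⊢
    constructor
    · refine two_smul_cancel (F := F) ?_
      linear_combination (norm := module) h1 + h2
    · refine two_smul_cancel (F := F) ?_
      linear_combination (norm := module) h1 - h2
  have hvw : (2 : F) • (v * w) = (1 - φ) • w := by
    have h1 := hbb.2
    rw [add_mul, smul_mul_assoc] at h1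
    linear_combination (norm := module) h1 - φ • haw
  have hww : w * w = (φ * (1 - φ)) • a + φ • v := by
    have h1 := hbb.1
    simp only [add_mul, mul_add, smul_mul_assoc, mul_smul_comm, mul_comm v a, hav, ha.idem,
      hvv] at h1
    linear_combination (norm := module) h1
  have hsw : s * w = (1 - φ) • w := by
    refine two_smul_cancel (F := F) ?_
    rw [hsv, add_mul, smul_mul_assoc]
    linear_combination (norm := module) (1 - φ) • haw + hvw
  have hsa : s * a = (1 - φ) • a := by
    rw [hsv, add_mul, smul_mul_assoc, ha.idem, mul_comm v a, hav, add_zero]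
  have hsv' : s * v = (1 - φ) • v := by
    rw [hsv, add_mul, smul_mul_assoc, hav, hvv, smul_zero, zero_add]
  have hss : s * s = (1 - φ) • s := by
    conv_lhs => rw [hsv, mul_add, ← hsv, mul_smul_comm, hsa, hsv']
    rw [hsv]
    module
  -- the quadratic equations for `b` and its image under the Miyamoto involution of `a`
  obtain ⟨u, hu⟩ : ∃ u, u = s + (2 * φ - 1) • a := ⟨_, rfl⟩
  have huv : u = φ • a + v := by rw [hu, hsv]; module
  have quad : ∀ x, (2 : F) • (u * (u * x)) + (2 : F) • (w * (w * x)) =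
        u * x + Q u x • u + Q w x • w ∧
      (2 : F) • (u * (w * x)) + (2 : F) • (w * (u * x)) = w * x + Q u x • w + Q w x • u := by
    intro x
    have h1 := hb.isCoeff.two_smul_mul_mul (F := F) x
    have h2 := hb'.isCoeff.two_smul_mul_mul (F := F) x
    rw [← hQ.apply_axis hb, hbs, ← hu] at h1
    rw [← hQ.apply_axis hb', ← hu] at h2
    simp only [add_mul, sub_mul, mul_add, mul_sub, map_add, map_sub, LinearMap.add_apply,
      LinearMap.sub_apply] at h1 h2
    -- With b = u + w and image u − w, the sum and difference separate the even and odd parts.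
    constructor
    · refine two_smul_cancel (F := F) ?_
      linear_combination (norm := module) h1 + h2
    · refine two_smul_cancel (F := F) ?_
      linear_combination (norm := module) h1 - h2
  have hQaz : ∀ z, a * z = 0 → Q a z = 0 := fun z hz => by
    rw [hQ.apply_axis ha, ha.isCoeff.apply_of_zero hz]
  have orth : ∀ z x, a * z = 0 → (2 : F) • (a * x) = x → Q z x = 0 := fun z x hz hx => by
    rw [← hx, map_smul, ← hQ.invariant, mul_comm z a, hz, map_zero, LinearMap.zero_apply,
      smul_zero]
  have hhalf : ∀ x, (2 : F) • (a * x) = x →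
      (2 : F) • (v * (v * x)) = (1 - φ) • (v * x) + Q v x • v := by
    intro x hx
    have hasx : ∀ {x}, (2 : F) • (a * x) = x → (2 : F) • (a * (s * x)) = s * x := fun {x} hx => by
      rw [has, ← mul_smul_comm, hx]
    have hux : ∀ {x}, (2 : F) • (a * x) = x →
        (2 : F) • (u * x) = (2 : F) • (s * x) + (2 * φ - 1) • x := fun {x} hx => by
      rw [hu, add_mul, smul_mul_assoc]
      linear_combination (norm := module) (2 * φ - 1) • hx
    have hvx : ∀ {x}, (2 : F) • (a * x) = x →
        (2 : F) • (v * x) = (2 : F) • (s * x) - (1 - φ) • x := fun {x} hx => by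
      rw [hsv, add_mul, smul_mul_assoc]
      linear_combination (norm := module) (-(1 - φ)) • hx
    have hQu : Q u x = 0 := by
      rw [huv, map_add, map_smul, LinearMap.add_apply, LinearMap.smul_apply, orth v x hav hx,
        hQ.apply_axis ha, ha.isCoeff.apply_of_half hx, smul_zero, add_zero]
    obtain ⟨q, hq⟩ : ∃ q, q = Q w x := ⟨_, rfl⟩
    have hawx : (2 : F) • (a * (w * x)) = q • a := by
      have h1 : 2 * Q (a * w) x = Q w x := by
        conv_rhs => rw [← haw, map_smul]
        rfl
      rw [ha.mul_mul_of_half_half haw hx, ← hQ.apply_axis ha, ← hQ.invariant, smul_smul, h1, hq]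
    have hodd : (4 : F) • (s * (w * x)) = (2 * (1 - φ)) • (w * x) + q • s := by
      have h1 := (quad x).2
      rw [hQu, ← hq] at h1
      have h2 := congrArg (w * ·) (hux hx)
      have h3 : u * (w * x) = s * (w * x) + (2 * φ - 1) • (a * (w * x)) := by
        rw [hu, add_mul, smul_mul_assoc]
      simp only [mul_add, mul_smul_comm, hws] at h2
      rw [h3, hu] at h1
      rw [hu] at h2
      linear_combination (norm := module) h1 - h2 - (2 * φ - 1) • hawx
    have heven : (4 : F) • (s * (s * x)) + (4 * (2 * φ - 1)) • (s * x) +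
        ((2 * φ - 1) ^ 2) • x + (4 : F) • (w * (w * x)) =
        (2 : F) • (s * x) + (2 * φ - 1) • x + (2 * q) • w := by
      have h1 := (quad x).1
      rw [hQu, ← hq] at h1
      have h2 := congrArg (u * ·) (hux hx)
      simp only [mul_add, mul_smul_comm] at h2
      linear_combination (norm := module)
        (2 : F) • h1 - (2 : F) • h2 - (2 : F) • hux (hasx hx) - (2 * φ - 1) • hux hx + hux hx
    -- On A_{1/2}(a), v acts as s − (1 − φ)/2, so y is 2v(vx) − (1 − φ)vx written in s. Both u and w
    -- annihilate it, so it lies in A_{1/2}(a) ∩ A_0(b) = 0.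
    obtain ⟨y, hy⟩ : ∃ y, y = (2 : F) • (s * (s * x)) - (3 * (1 - φ)) • (s * x) +
      ((1 - φ) ^ 2) • x := ⟨_, rfl⟩
    have hay : (2 : F) • (a * y) = y := by
      rw [hy]
      simp only [mul_add, mul_sub, mul_smul_comm]
      linear_combination (norm := module)
        (2 : F) • hasx (hasx hx) - (3 * (1 - φ)) • hasx hx + ((1 - φ) ^ 2) • hx
    have hwy : w * y = 0 := by
      refine two_smul_cancel (F := F) ?_
      have h1 := congrArg (s * ·) hodd
      simp only [mul_add, mul_smul_comm, hss] at h1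
      rw [hy]
      simp only [mul_add, mul_sub, mul_smul_comm, hws]
      linear_combination (norm := module) h1 - (1 - φ) • hodd
    have huy : u * y = 0 := by
      refine two_smul_cancel (F := F) (two_smul_cancel (F := F) ?_)
      have h1 := congrArg (s * ·) heven
      have h2 := congrArg (w * ·) hodd
      simp only [mul_add, mul_smul_comm, hsw, hws, mul_comm w s] at h1 h2
      rw [hux hay, hy]
      simp only [mul_add, mul_sub, mul_smul_comm]
      linear_combination (norm := module) (2 : F) • h1 - (1 - φ) • heven - (2 : F) • h2
    have hby : b * y = 0 := by rw [hbs, ← hu, add_mul, huy, hwy, add_zero]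
    have hy0 := ha.eq_zero_of_half_of_zero hb (hφ' ▸ hφ0) hay hby
    rw [hy] at hy0
    rw [orth v x hav hx]
    refine two_smul_cancel (F := F) ?_
    have h1 := congrArg (v * ·) (hvx hx)
    simp only [mul_sub, mul_smul_comm] at h1
    linear_combination (norm := module)
      (2 : F) • h1 + (2 : F) • hvx (hasx hx) - (2 * (1 - φ)) • hvx hx + (2 : F) • hy0
  have hzero : ∀ x, a * x = 0 →
      (2 : F) • (v * (v * x)) = (1 - φ) • (v * x) + Q v x • v := by
    intro x hx
    have hasx : ∀ {x}, a * x = 0 → a * (s * x) = 0 := fun {x} hx => by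
      rw [has, hx, mul_zero]
    have hux : ∀ {x}, a * x = 0 → u * x = s * x := fun {x} hx => by
      rw [hu, add_mul, smul_mul_assoc, hx, smul_zero, add_zero]
    have hvx : ∀ {x}, a * x = 0 → v * x = s * x := fun {x} hx => by
      rw [hsv, add_mul, smul_mul_assoc, hx, smul_zero, zero_add]
    obtain ⟨q, hq⟩ : ∃ q, q = Q v x := ⟨_, rfl⟩
    have hQw : Q w x = 0 := by rw [hQ.symm, orth x w hx haw]
    have hQu : Q u x = q := by
      rw [huv, map_add, map_smul, LinearMap.add_apply, LinearMap.smul_apply, hQaz x hx, smul_zero,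
        zero_add, hq]
    have hawx : (2 : F) • (a * (w * x)) = w * x := by
      rw [mul_comm w x]
      exact ha.two_smul_mul_mul_of_zero_half hx haw
    have hodd : (4 : F) • (s * (w * x)) = (2 * (1 - φ)) • (w * x) + q • w := by
      have h1 := (quad x).2
      have h3 : u * (w * x) = s * (w * x) + (2 * φ - 1) • (a * (w * x)) := by
        rw [hu, add_mul, smul_mul_assoc]
      rw [hQu, hQw, h3, hux hx, hws] at h1
      linear_combination (norm := module) h1 - (2 * φ - 1) • hawx
    have heven : (2 : F) • (s * (s * x)) + (2 : F) • (w * (w * x)) = s * x + q • u := by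
      have h1 := (quad x).1
      rw [hQu, hQw, hux hx, hux (hasx hx)] at h1
      linear_combination (norm := module) h1
    -- On A_0(a), v acts as s, so y is the defect of the desired identity. Here wy = 0 and sy = y/2,
    -- placing y in A_0(a) ∩ A_{1/2}(b) = 0.
    obtain ⟨y, hy⟩ : ∃ y, y = (2 : F) • (s * (s * x)) - (1 - φ) • (s * x) - q • v := ⟨_, rfl⟩
    have hay : a * y = 0 := by
      rw [hy]
      simp only [mul_sub, mul_smul_comm, hasx (hasx hx), hasx hx, hav, smul_zero, sub_zero]
    have hwy : w * y = 0 := by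
      refine two_smul_cancel (F := F) ?_
      have h1 := congrArg (s * ·) hodd
      simp only [mul_add, mul_smul_comm, hsw] at h1
      rw [hy]
      simp only [mul_sub, mul_smul_comm, hws, mul_comm w v]
      linear_combination (norm := module) h1 - q • hvw
    have hsy : (2 : F) • (s * y) = y := by
      have h1 := congrArg (s * ·) heven
      have h2 := congrArg (w * ·) hodd
      rw [huv] at h1 heven
      simp only [mul_add, mul_smul_comm, hsa, hsv', hws, hww] at h1 h2
      rw [hy]
      simp only [mul_sub, mul_smul_comm, hsv']
      linear_combination (norm := module) (2 : F) • h1 - (1 - φ) • heven - h2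
    have hby : (2 : F) • (b * y) = y := by
      rw [hbs, ← hu, add_mul, hwy, add_zero, hux hay, hsy]
    have hy0 := hb.eq_zero_of_half_of_zero ha (hφ'' ▸ hφ0) hby hay
    rw [hy] at hy0
    rw [hvx hx, hvx (hasx hx), ← hq]
    linear_combination (norm := module) hy0
  refine ⟨hvv, fun x => ?_⟩
  obtain ⟨y, z, hy, hz, hx⟩ := ha.exists_components (F := F) x
  rw [hx]
  simp only [mul_add, map_add, map_smul, mul_smul_comm, mul_comm v a, hav, hQ.symm v a,
    hQaz v hav, smul_zero, zero_add]
  linear_combination (norm := module) hhalf y hy + hzero z hz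

end
end JordanAxial

/-! ### Subalgebras and the elements x_a(b) -/

namespace JordanAxial

section
variable {F A : Type*} [Field F] [NonUnitalNonAssocCommRing A] [Module F A]
  [IsScalarTower F A A] [SMulCommClass F A A]

/-- Being an identity, the quadratic condition restricts to subalgebras. Axes thus restrict, and
uniqueness of coefficients makes the Frobenius forms agree on them. -/
theorem IsCoeff.restrict {B : NonUnitalSubalgebra F A} {e : A} {f : A →ₗ[F] F}
    (h : IsCoeff e f) (he : e ∈ B) :
    IsCoeff (⟨e, he⟩ : B)
      (f ∘ₗ ((NonUnitalSubalgebraClass.subtype B : B →ₙₐ[F] A) : B →ₗ[F] A)) where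
  apply_self := h.apply_self
  two_smul_mul_mul x := Subtype.ext (h.two_smul_mul_mul x)

variable [NeZero (2 : F)]

/-- An axis of `A` in a subalgebra is an axis of the subalgebra. -/
theorem IsAxis.isAxisOf {B : NonUnitalSubalgebra F A} {e : A} (h : IsAxis F e) (he : e ∈ B) :
    IsAxisOf F B e := by
  refine ⟨he, (h.isCoeff.restrict he).isAxis (Subtype.ext h.idem) ?_ ?_ ?_⟩
  · intro x y hx hy
    exact Subtype.ext (h.mul_mul_of_zero_zero (congrArg Subtype.val hx) (congrArg Subtype.val hy))
  · intro x y hx hy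
    exact Subtype.ext (h.mul_mul_of_half_half (F := F) (congrArg Subtype.val hx)
      (congrArg Subtype.val hy))
  · intro x y hx hy
    exact Subtype.ext (h.two_smul_mul_mul_of_zero_half (F := F) (congrArg Subtype.val hx)
      (congrArg Subtype.val hy))

theorem IsAxialAlgebra.frobeniusForm_axis (hA : IsAxialAlgebra F A) {a : A} (ha : IsAxis F a)
    (x : A) : frobeniusForm F A a x = coeff (F := F) a x :=
  hA.isFrobeniusForm.apply_axis ha x

/-- On axes in a subalgebra that is itself axial, the two Frobenius forms agree. -/
theorem IsAxialAlgebra.frobeniusForm_subalgebra (hA : IsAxialAlgebra F A)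
    {B : NonUnitalSubalgebra F A} (hB : IsAxialAlgebra F B) {x : B} (hx : IsAxis F (x : A))
    (y : B) : frobeniusForm F B x y = frobeniusForm F A x y := by
  obtain ⟨h, hx'⟩ := hx.isAxisOf x.2
  rw [hA.frobeniusForm_axis hx, hB.frobeniusForm_axis hx', (hx.isCoeff.restrict h).coeff_eq]
  rfl

theorem one_sub_smul_xIdem {a b : A} (h : frobeniusForm F A a b ≠ 1) :
    (1 - frobeniusForm F A a b) • xIdem F a b =
      b - (2 : F) • (a * b) + frobeniusForm F A a b • a := by
  rw [xIdem, smul_smul, ← neg_sub, neg_mul, mul_inv_cancel₀ (sub_ne_zero.2 h)]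
  module

theorem mul_xIdem (hA : IsAxialAlgebra F A) {a : A} (ha : IsAxis F a) (b : A) :
    a * xIdem F a b = 0 := by
  have h := ha.isCoeff.mul_zero_component (F := F) ha.idem b
  rw [xIdem, hA.frobeniusForm_axis ha, mul_smul_comm,
    show (2 : F) • (a * b) - coeff (F := F) a b • a - b =
      -(b - (2 : F) • (a * b) + coeff (F := F) a b • a) by module, mul_neg, h, neg_zero, smul_zero]

theorem xIdem_mem {B : NonUnitalSubalgebra F A} {a b : A} (ha : a ∈ B) (hb : b ∈ B) :
    xIdem F a b ∈ B :=
  SMulMemClass.smul_mem _ (sub_mem (sub_mem (SMulMemClass.smul_mem _ (mul_mem ha hb))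
    (SMulMemClass.smul_mem _ ha)) hb)

/-- For distinct axes `a` and `b`, the element `x_a(b)` is an axis. -/
theorem isAxis_xIdem (hA : IsAxialAlgebra F A) (hqd : IsQuasiDefinite F A)
    (hsa : IsStronglyAxial F A) {a b : A} (ha : IsAxis F a) (hb : IsAxis F b) (hab : a ≠ b) :
    IsAxis F (xIdem F a b) := by
  have hQ := hA.isFrobeniusForm
  have h1 := hqd a b ha hb hab
  have hab' : frobeniusForm F A b (a * b) = frobeniusForm F A a b := by
    rw [mul_comm, ← hQ.invariant, hb.idem, hQ.symm]
  by_cases h0 : frobeniusForm F A a b = 0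
  -- For φ = 0 this value forces b to be fixed by the involution of a; then ab = 0 and x_a(b) = b.
  · have h2 : frobeniusForm F A b (miyamoto (F := F) a b) = 1 := by
      rw [miyamoto_apply, ← hA.frobeniusForm_axis ha, h0, map_add, map_sub, map_smul, hab', h0,
        hQ.normalized b hb]
      simp
    have h3 : b = miyamoto (F := F) a b := by
      by_contra h
      exact hqd _ _ hb (ha.miyamoto hb) h h2
    have h4 : (2 : F) • (a * b) = 0 := by
      rw [miyamoto_apply, ← hA.frobeniusForm_axis ha, h0] at h3
      refine two_smul_cancel (F := F) ?_
      linear_combination (norm := module) h3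
    have h5 := one_sub_smul_xIdem h1
    rw [h0, h4, sub_zero, one_smul, zero_smul, sub_zero, add_zero] at h5
    rwa [h5]
  · obtain ⟨φ, hφ⟩ : ∃ φ, φ = frobeniusForm F A a b := ⟨_, rfl⟩
    obtain ⟨e, he⟩ : ∃ e, e = xIdem F a b := ⟨_, rfl⟩
    have hv := one_sub_smul_xIdem h1
    rw [← hφ] at h0 h1 hv
    rw [← he] at hv ⊢
    have hc : 1 - φ ≠ 0 := sub_ne_zero.2 (Ne.symm h1)
    obtain ⟨hidem, hquad⟩ := hQ.two_smul_mul_mul_zero_component ha hb hφ h0 hv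
    have hi : e * e = e := by
      rw [smul_mul_assoc, mul_smul_comm] at hidem
      exact smul_right_injective A hc (smul_right_injective A hc hidem)
    have hQae : frobeniusForm F A e a = 0 := by
      rw [hQ.symm, hA.frobeniusForm_axis ha, ha.isCoeff.apply_of_zero (he ▸ mul_xIdem hA ha b)]
    have hQabe : frobeniusForm F A e (a * b) = 0 := by
      rw [← hQ.invariant, mul_comm, he, mul_xIdem hA ha b, map_zero, LinearMap.zero_apply]
    have hQbe : frobeniusForm F A b e = 1 - φ := by
      have h2 := congrArg (frobeniusForm F A b) hv
      simp only [map_add, map_sub, map_smul, hab', hQ.normalized b hb, hQ.symm b a, ← hφ,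
        smul_eq_mul] at h2
      refine mul_left_cancel₀ hc ?_
      linear_combination h2
    -- Divide the identity for v = (1 − φ)e by (1 − φ)²; the normalization (e,e) = 1 comes from
    -- (e,b) = 1 − φ and (e,a) = (e,ab) = 0.
    have hcoeff : IsCoeff e (frobeniusForm F A e) := by
      refine ⟨?_, fun x => ?_⟩
      · have h2 := congrArg (frobeniusForm F A e) hv
        simp only [map_add, map_sub, map_smul, hQae, hQabe, hQ.symm e b, hQbe,
          smul_eq_mul] at h2
        refine mul_left_cancel₀ hc ?_
        linear_combination h2
      · have h2 := hquad x
        simp only [map_smul, smul_mul_assoc, mul_smul_comm, LinearMap.smul_apply] at h2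
        refine smul_right_injective A hc (smul_right_injective A hc ?_)
        linear_combination (norm := module) h2
    exact hsa e (hcoeff.isPrimitiveSemisimpleIdempotent hi)

/-- If `X` is a spanning set of axes, the elements `x_a(x)` for `x ∈ X`, `x ≠ a`,
span `A_0(a)`. -/
theorem span_xIdem_eq_top (hA : IsAxialAlgebra F A) (hqd : IsQuasiDefinite F A) {a : A}
    (ha : IsAxis F a) {X : Set A} (hX : ∀ x ∈ X, IsAxis F x) (hspan : Submodule.span F X = ⊤) :
    Submodule.span F {y : zeroSubalgebra ha | ∃ x ∈ X, x ≠ a ∧ (y : A) = xIdem F a x} = ⊤ := by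
  -- The projection onto A_0(a) kills a, sends any other x in X to a multiple of x_a(x), and is the
  -- identity on A_0(a).
  let p : A →ₗ[F] zeroSubalgebra ha :=
    (LinearMap.id - (2 : F) • LinearMap.mulLeft F a + (coeff a).smulRight a).codRestrict
      (zeroSubalgebra ha).toSubmodule
      fun x => (mem_zeroSubalgebra ha).2 (ha.isCoeff.mul_zero_component ha.idem x)
  have hp : ∀ x, (p x : A) = x - (2 : F) • (a * x) + coeff (F := F) a x • a := fun x => rfl
  have hle : (⊤ : Submodule F A) ≤ (Submodule.span F
      {y : zeroSubalgebra ha | ∃ x ∈ X, x ≠ a ∧ (y : A) = xIdem F a x}).comap p := by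
    rw [← hspan, Submodule.span_le]
    intro x hx
    rw [SetLike.mem_coe, Submodule.mem_comap]
    by_cases hxa : x = a
    · have h0 : p x = 0 := Subtype.ext (by
        rw [hp, hxa, ha.idem, ha.isCoeff.apply_self, ZeroMemClass.coe_zero]
        module)
      rw [h0]
      exact zero_mem _
    · have h1 : p x = (1 - frobeniusForm F A a x) •
          (⟨xIdem F a x, (mem_zeroSubalgebra ha).2 (mul_xIdem hA ha x)⟩ : zeroSubalgebra ha) :=
        Subtype.ext (by
          rw [hp]
          change _ = (1 - frobeniusForm F A a x) • xIdem F a x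
          rw [one_sub_smul_xIdem (hqd a x ha (hX x hx) (Ne.symm hxa)), hA.frobeniusForm_axis ha])
      rw [h1]
      exact Submodule.smul_mem _ _ (Submodule.subset_span ⟨x, hx, hxa, rfl⟩)
  refine eq_top_iff.2 fun y _ => ?_
  have hy := (mem_zeroSubalgebra ha).1 y.2
  have h : p y = y := Subtype.ext (by
    rw [hp, hy, ha.isCoeff.apply_of_zero hy]
    module)
  rw [← h]
  exact hle (Submodule.mem_top (x := (y : A)))

end
end JordanAxial

/-! ### The main theorem -/

theorem mainTheorem4 {F A : Type*} [Field F] [NonUnitalNonAssocCommRing A] [Module F A]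
    [IsScalarTower F A A] [SMulCommClass F A A] (hF : (2 : F) ≠ 0)
    (hA : JordanAxial.IsAxialAlgebra F A)
    (hqd : JordanAxial.IsQuasiDefinite F A)
    (hsa : JordanAxial.IsStronglyAxial F A) :
    (∃! Q : LinearMap.BilinForm F A, JordanAxial.IsFrobeniusForm F Q) ∧
    (∀ (a b : A) (ha : JordanAxial.IsAxis F a), JordanAxial.IsAxis F b → a ≠ b →
      JordanAxial.IsAxis F (JordanAxial.xIdem F a b) ∧
      JordanAxial.IsAxisOf F (JordanAxial.zeroSubalgebra ha) (JordanAxial.xIdem F a b) ∧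
      ∀ B : NonUnitalSubalgebra F A, a ∈ B → b ∈ B →
        JordanAxial.IsAxisOf F B (JordanAxial.xIdem F a b) ∧
        JordanAxial.IsAxisOf F (JordanAxial.zeroSubalgebra ha ⊓ B) (JordanAxial.xIdem F a b)) ∧
    (1 < Module.rank F A →
      (∃ X : Set A, JordanAxial.IsAxisBasis F X) ∧
      ∀ (a : A) (ha : JordanAxial.IsAxis F a),
        JordanAxial.IsAxialAlgebra F (JordanAxial.zeroSubalgebra ha) ∧
        (∃! Q : LinearMap.BilinForm F (JordanAxial.zeroSubalgebra ha),
          JordanAxial.IsFrobeniusForm F Q) ∧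
        ∀ X : Set A, JordanAxial.IsAxisBasis F X →
          ∃ Y : Set (JordanAxial.zeroSubalgebra ha),
            JordanAxial.IsQuasiDefiniteBasis F Y ∧
            ∀ y ∈ Y, ∃ x ∈ X, x ≠ a ∧ (y : A) = JordanAxial.xIdem F a x) := by
  have : NeZero (2 : F) := ⟨hF⟩
  have haxis := fun (a b : A) (ha : JordanAxial.IsAxis F a) (hb : JordanAxial.IsAxis F b)
    (hab : a ≠ b) => JordanAxial.isAxis_xIdem hA hqd hsa ha hb hab
  have hmem := fun (a b : A) (ha : JordanAxial.IsAxis F a) =>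
    (JordanAxial.mem_zeroSubalgebra ha).2 (JordanAxial.mul_xIdem hA ha b)
  obtain ⟨X₀, -, hX₀⟩ := JordanAxial.exists_isAxisBasis_subset (fun x hx => hx) hA.span_eq_top
  refine ⟨hA.existsUnique_isFrobeniusForm, ?_, fun _ => ⟨⟨X₀, hX₀⟩, fun a ha => ?_⟩⟩
  · intro a b ha hb hab
    have h := haxis a b ha hb hab
    exact ⟨h, h.isAxisOf (hmem a b ha), fun B haB hbB =>
      ⟨h.isAxisOf (JordanAxial.xIdem_mem haB hbB),
        h.isAxisOf ⟨hmem a b ha, JordanAxial.xIdem_mem haB hbB⟩⟩⟩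
  · have hsub : ∀ X : Set A, JordanAxial.IsAxisBasis F X →
        ∀ y ∈ {y : JordanAxial.zeroSubalgebra ha |
          ∃ x ∈ X, x ≠ a ∧ (y : A) = JordanAxial.xIdem F a x},
        JordanAxial.IsAxis F (y : A) ∧ JordanAxial.IsAxis F y := by
      rintro X hX y ⟨x, hx, hxa, hy⟩
      have h : JordanAxial.IsAxis F (y : A) := hy ▸ haxis a x ha (hX.axis x hx) (Ne.symm hxa)
      exact ⟨h, (h.isAxisOf y.2).2⟩
    have hB : JordanAxial.IsAxialAlgebra F (JordanAxial.zeroSubalgebra ha) :=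
      JordanAxial.IsAxialAlgebra.of_span_eq_top (fun y hy => (hsub X₀ hX₀ y hy).2)
        (JordanAxial.span_xIdem_eq_top hA hqd ha hX₀.axis hX₀.span_eq_top)
    refine ⟨hB, hB.existsUnique_isFrobeniusForm, fun X hX => ?_⟩
    obtain ⟨Y, hYX, hY⟩ := JordanAxial.exists_isAxisBasis_subset
      (fun y hy => (hsub X hX y hy).2)
      (JordanAxial.span_xIdem_eq_top hA hqd ha hX.axis hX.span_eq_top)
    refine ⟨Y, ⟨hY, fun x hx y hy hxy => ?_⟩, hYX⟩
    have hx' := (hsub X hX x (hYX hx)).1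
    -- The chosen basis vectors are axes of A as well, so the form of A_0(a) can be replaced by that
    -- of A, where quasi-definiteness applies.
    rw [hA.frobeniusForm_subalgebra hB hx']
    exact hqd x y hx' (hsub X hX y (hYX hy)).1 (fun h => hxy (Subtype.ext h))
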